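/- Let $S\subset\mathbb{Z}$ be a finite set, let $l_1,r_1,l_2,r_2\ge 0$ be integers, and let $F$ be a two-dimensional cellular automaton with set of states $S$, neighborhood $N=\{-l_1,\ldots,r_1\}\times\{-l_2,\ldots,r_2\}$ and local rule $f:S^N\to S$; its global map $F:S^{\mathbb{Z}^2}\to S^{\mathbb{Z}^2}$ is $F(c)_i=f\big((c_{i+v})_{v\in N}\big)$. Call $F$ number-conserving if for every configuration $c\in S^{\mathbb{Z}^2}$ and all positive integers $p_1,p_2$ such that $c_{(i+p_1,j)}=c_{(i,j+p_2)}=c_{(i,j)}$ for all $(i,j)\in\mathbb{Z}^2$, $$\sum_{0\le k_1<p_1}\ \sum_{0\le k_2<p_2} c_{(k_1,k_2)}=\sum_{0\le k_1<p_1}\ \sum_{0\le k_2<p_2} F(c)_{(k_1,k_2)} .$$ Put $n=l_1+r_1+1$ and $m=l_2+r_2+1$, and regard elements of $S^N$ as $m\times n$ matrices over $S$, where the entry in row $i$ and column $j$ ($1\le i\le m$, $1\le j\le n$) is the state of the neighbor $(j-1-l_1,\;i-1-l_2)$. Let $a\in S$ be any state. Then $F$ is number-conserving if and only if, for all $(x_{i,j})_{1\le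 i\le m,\,1\le j\le n}\in S^{mn}$, $$\begin{aligned} f(M_{1,1,m,n})={}&x_{1,1}+\sum_{i=1}^{m-1}\big(f(M_{2,1,i+1,n})-f(M_{1,1,i,n})\big)+\sum_{j=1}^{n-1}\big(f(M_{1,2,m,j+1})-f(M_{1,1,m,j})\big)\\&+\sum_{i=1}^{m-1}\sum_{j=1}^{n-1}\big(f(M_{1,2,i,j+1})+f(M_{2,1,i+1,j})-f(M_{1,1,i,j})-f(M_{2,2,i+1,j+1})\big),\end{aligned}$$ where $M_{T,L,B,R}$ is the $m\times n$ matrix filled with $a$'s except for its bottom right corner, which is occupied by the block $(x_{i,j})_{T\le i\le B,\;L\le j\le R}$ (so that $x_{B,R}$ stands in row $m$, column $n$). -/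

import Mathlib

/-- The rectangular neighborhood `{-l₁,…,r₁} × {-l₂,…,r₂} ⊂ ℤ²`. -/
noncomputable def rectNbhd (l₁ r₁ l₂ r₂ : ℕ) : Finset (ℤ × ℤ) :=
  Finset.Icc (-(l₁ : ℤ)) (r₁ : ℤ) ×ˢ Finset.Icc (-(l₂ : ℤ)) (r₂ : ℤ)

/-- A two-dimensional cellular automaton with finite set of states `S ⊂ ℤ` and finite
neighborhood `N ⊂ ℤ²`: it is given by its local transition rule `f : S^N → S`. -/
structure CellularAutomaton (S : Finset ℤ) (N : Finset (ℤ × ℤ)) where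
  /-- the local transition rule -/
  f : (N → S) → S

namespace CellularAutomaton

/-- The global map `S^{ℤ²} → S^{ℤ²}`: the new state of the cell `i` is the local rule applied
to the restriction of the configuration to `i + N`. -/
def next {S : Finset ℤ} {N : Finset (ℤ × ℤ)} (F : CellularAutomaton S N)
    (c : ℤ × ℤ → S) : ℤ × ℤ → S :=
  fun i => F.f (fun v => c (i + v.1))

/-- `(p₁, p₂)` (positive integers) is a period of the configuration `c` : `c` is invariant under
translation by `p₁` in the first and by `p₂` in the second direction. -/
def IsPeriod {S : Finset ℤ} (c : ℤ × ℤ → S) (p₁ p₂ : ℕ) : Prop :=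
  0 < p₁ ∧ 0 < p₂ ∧
    (∀ i j : ℤ, c (i + p₁, j) = c (i, j)) ∧ (∀ i j : ℤ, c (i, j + p₂) = c (i, j))

/-- The sum of the states over the fundamental cell `{0,…,p₁-1} × {0,…,p₂-1}`. -/
def cellSum {S : Finset ℤ} (c : ℤ × ℤ → S) (p₁ p₂ : ℕ) : ℤ :=
  ∑ i ∈ Finset.range p₁, ∑ j ∈ Finset.range p₂, (c ((i : ℤ), (j : ℤ)) : ℤ)

/-- Number conservation: for every periodic configuration, the sum of the states over a period
is unchanged by the global map. -/
def NumberConserving {S : Finset ℤ} {N : Finset (ℤ × ℤ)} (F : CellularAutomaton S N) : Prop :=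
  ∀ (c : ℤ × ℤ → S) (p₁ p₂ : ℕ), IsPeriod c p₁ p₂ →
    cellSum c p₁ p₂ = cellSum (F.next c) p₁ p₂

/-- The local rule of an automaton with rectangular neighborhood, applied to a matrix with
`l₂ + r₂ + 1` rows and `l₁ + r₁ + 1` columns: the (zero-based) row `p` and column `q` of the
matrix hold the state of the neighbor `(q - l₁, p - l₂)`. -/
def onMatrix {S : Finset ℤ} {l₁ r₁ l₂ r₂ : ℕ} (F : CellularAutomaton S (rectNbhd l₁ r₁ l₂ r₂))
    (A : Matrix (Fin (l₂ + r₂ + 1)) (Fin (l₁ + r₁ + 1)) S) : S :=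
  F.f (fun v => A
    ⟨(v.1.2 + l₂).toNat, by
      have h := v.2
      simp only [rectNbhd, Finset.mem_product, Finset.mem_Icc] at h
      omega⟩
    ⟨(v.1.1 + l₁).toNat, by
      have h := v.2
      simp only [rectNbhd, Finset.mem_product, Finset.mem_Icc] at h
      omega⟩)

end CellularAutomaton

/-- The entry `x_{i,j}` of an `m × n` matrix, with indices `1 ≤ i ≤ m`, `1 ≤ j ≤ n` starting
from one (outside of this range, the value is `a`). -/
def entry {α : Type*} {m n : ℕ} (a : α) (x : Matrix (Fin m) (Fin n) α) (i j : ℕ) : α :=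
  if h : (1 ≤ i ∧ i ≤ m) ∧ (1 ≤ j ∧ j ≤ n) then
    x ⟨i - 1, by omega⟩ ⟨j - 1, by omega⟩
  else a

/-- The `m × n` matrix `M_{T,L,B,R}`, filled with `a` except for its bottom right corner, which
is occupied by the block `(x_{i,j})` with `T ≤ i ≤ B`, `L ≤ j ≤ R` (where `1 ≤ T ≤ B ≤ m` and
`1 ≤ L ≤ R ≤ n`, indices starting from one). Thus `x_{B,R}` stands at the place `(m, n)`, and
the place `(p, q)` holds `x_{p+B-m, q+R-n}` if `T ≤ p+B-m` and `L ≤ q+R-n`. -/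
def cornerMatrix {α : Type*} {m n : ℕ} (a : α) (x : Matrix (Fin m) (Fin n) α) (T L B R : ℕ) :
    Matrix (Fin m) (Fin n) α :=
  fun p q =>
    if T + m ≤ ((p : ℕ) + 1) + B ∧ L + n ≤ ((q : ℕ) + 1) + R then
      entry a x (((p : ℕ) + 1) + B - m) (((q : ℕ) + 1) + R - n)
    else a

/-! Necessity: place `x` on a torus of size `2n × 2m` filled with `a`, and take the mixed difference
of the cell sums over four variants: `x` intact, first row erased, first column erased, both erased.
Before applying `F` it is `x₁₁ - a`. Afterwards, a window missing the first row or the first column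
contributes zero, and the remaining `mn` windows show exactly the corner matrices. Equating the two
sides and solving for the full block by `sum_mixed_difference` gives the formula; empty blocks
contribute `f(a,…,a) = a`.

Sufficiency: apply the formula to every window of a periodic configuration and sum over a period. By
translation, the sum of a block term depends only on the block's size
(`sum_onMatrix_cornerMatrix_window`). In each bracket blocks of equal size occur with opposite
signs, so only the sum of the `x₁₁`, a translated cell sum, survives. -/

/-! ### Summation identities and empty blocks -/

theorem sum_range_add_of_periodic (h : ℤ → ℤ) (p : ℕ) (hp : ∀ i, h (i + p) = h i) (s : ℤ) :
    ∑ i ∈ Finset.range p, h (i + s) = ∑ i ∈ Finset.range p, h i := by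
  have step : ∀ t : ℤ, ∑ i ∈ Finset.range p, h (i + (t + 1)) =
      ∑ i ∈ Finset.range p, h (i + t) := by
    intro t
    have h1 := Finset.sum_range_succ (fun i : ℕ => h (i + t)) p
    have h2 := Finset.sum_range_succ' (fun i : ℕ => h (i + t)) p
    have h3 : h ((p : ℤ) + t) = h t := by rw [add_comm, hp]
    simp only [Nat.cast_add, Nat.cast_one, Nat.cast_zero, zero_add] at h1 h2
    have h4 : ∀ i : ℕ, h ((i : ℤ) + (t + 1)) = h ((i : ℤ) + 1 + t) := fun i => by
      congr 1; ring
    simp only [h4]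
    linarith
  induction s using Int.induction_on with
  | zero => simp
  | succ k ih => rw [step, ih]
  | pred k ih =>
    have := step (-(k : ℤ) - 1)
    rw [sub_add_cancel] at this
    rw [← this, ih]

theorem sum_range_range_add_of_periodic (g : ℤ × ℤ → ℤ) (p₁ p₂ : ℕ)
    (h₁ : ∀ i j, g (i + p₁, j) = g (i, j)) (h₂ : ∀ i j, g (i, j + p₂) = g (i, j)) (s t : ℤ) :
    ∑ i ∈ Finset.range p₁, ∑ j ∈ Finset.range p₂, g (i + s, j + t) =
      ∑ i ∈ Finset.range p₁, ∑ j ∈ Finset.range p₂, g (i, j) := by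
  rw [sum_range_add_of_periodic (fun i => ∑ j ∈ Finset.range p₂, g (i, j + t)) p₁
    (fun i => by simp only [h₁])]
  exact Finset.sum_congr rfl fun i _ =>
    sum_range_add_of_periodic (fun j => g (i, j)) p₂ (fun j => h₂ _ _) t

theorem sum_Icc_one_eq_sum_range (g : ℕ → ℤ) (k : ℕ) :
    ∑ i ∈ Finset.Icc 1 k, g i = ∑ i ∈ Finset.range k, g (i + 1) := by
  rw [Finset.range_eq_Ico, Finset.sum_Ico_add' g 0 k 1]
  rfl

/-- Regrouping of a sum of mixed second differences over a rectangle, when the subtracted terms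
are constant along its first row or column. -/
theorem sum_mixed_difference (A B C D : ℕ → ℕ → ℤ) (α : ℤ) (hB : ∀ j, B 1 j = α)
    (hC : ∀ i, C i 1 = α) (hD : ∀ j, D 1 j = α) (hD' : ∀ i, D i 1 = α) (M N : ℕ) :
    ∑ i ∈ Finset.range (M + 1), ∑ j ∈ Finset.range (N + 1),
      (A (i + 1) (j + 1) - B (i + 1) (j + 1) - C (i + 1) (j + 1) + D (i + 1) (j + 1)) =
    A (M + 1) (N + 1) - α
      - ∑ i ∈ Finset.Icc 1 M, (B (i + 1) (N + 1) - A i (N + 1))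
      - ∑ j ∈ Finset.Icc 1 N, (C (M + 1) (j + 1) - A (M + 1) j)
      - ∑ i ∈ Finset.Icc 1 M, ∑ j ∈ Finset.Icc 1 N,
          (C i (j + 1) + B (i + 1) j - A i j - D (i + 1) (j + 1)) := by
  simp only [sum_Icc_one_eq_sum_range, Finset.sum_add_distrib, Finset.sum_sub_distrib]
  have eA : ∑ i ∈ Finset.range (M + 1), ∑ j ∈ Finset.range (N + 1), A (i + 1) (j + 1) =
      ∑ i ∈ Finset.range M, ∑ j ∈ Finset.range N, A (i + 1) (j + 1)
      + ∑ i ∈ Finset.range M, A (i + 1) (N + 1)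
      + ∑ j ∈ Finset.range N, A (M + 1) (j + 1) + A (M + 1) (N + 1) := by
    simp only [Finset.sum_range_succ, Finset.sum_add_distrib]; ring
  have eB : ∑ i ∈ Finset.range (M + 1), ∑ j ∈ Finset.range (N + 1), B (i + 1) (j + 1) =
      ∑ i ∈ Finset.range M, ∑ j ∈ Finset.range N, B (i + 1 + 1) (j + 1)
      + ∑ i ∈ Finset.range M, B (i + 1 + 1) (N + 1) + (N + 1) * α := by
    rw [Finset.sum_range_succ']
    simp only [Finset.sum_range_succ _ N, Finset.sum_add_distrib, zero_add, hB, Finset.sum_const,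
      Finset.card_range, nsmul_eq_mul]
    ring
  have eC : ∑ i ∈ Finset.range (M + 1), ∑ j ∈ Finset.range (N + 1), C (i + 1) (j + 1) =
      ∑ i ∈ Finset.range M, ∑ j ∈ Finset.range N, C (i + 1) (j + 1 + 1)
      + ∑ j ∈ Finset.range N, C (M + 1) (j + 1 + 1) + (M + 1) * α := by
    rw [Finset.sum_range_succ]
    simp only [Finset.sum_range_succ' _ N, Finset.sum_add_distrib, zero_add, hC, Finset.sum_const,
      Finset.card_range, nsmul_eq_mul]
    ring
  have eD : ∑ i ∈ Finset.range (M + 1), ∑ j ∈ Finset.range (N + 1), D (i + 1) (j + 1) =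
      ∑ i ∈ Finset.range M, ∑ j ∈ Finset.range N, D (i + 1 + 1) (j + 1 + 1)
      + (M + N + 1) * α := by
    rw [Finset.sum_range_succ']
    simp only [Finset.sum_range_succ' _ N, Finset.sum_add_distrib, zero_add, hD, hD',
      Finset.sum_const, Finset.card_range, nsmul_eq_mul]
    ring
  -- The multiples of `α` add up to `-(N+1) - (M+1) + (M+N+1) = -1`.
  rw [eA, eB, eC, eD]
  ring

theorem cornerMatrix_eq_const {α : Type*} {m n : ℕ} (a : α) (x : Matrix (Fin m) (Fin n) α)
    {T L B R : ℕ} (h : B < T ∨ R < L) : cornerMatrix a x T L B R = fun _ _ => a := by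
  funext p q
  have := p.2
  have := q.2
  exact if_neg (by omega)

theorem entry_of_gt {α : Type*} {m n : ℕ} (a : α) (x : Matrix (Fin m) (Fin n) α)
    {i j : ℕ} (h : m < i ∨ n < j) : entry a x i j = a :=
  dif_neg (by omega)

/-! ### Windows and periods -/

namespace CellularAutomaton

variable {S : Finset ℤ}

/-- The states around the cell `k`, arranged in a matrix as in `onMatrix`. -/
def window (l₁ r₁ l₂ r₂ : ℕ) (c : ℤ × ℤ → S) (k : ℤ × ℤ) :
    Matrix (Fin (l₂ + r₂ + 1)) (Fin (l₁ + r₁ + 1)) S :=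
  fun p q => c (k.1 + (q : ℕ) - l₁, k.2 + (p : ℕ) - l₂)

theorem onMatrix_window {l₁ r₁ l₂ r₂ : ℕ} (F : CellularAutomaton S (rectNbhd l₁ r₁ l₂ r₂))
    (c : ℤ × ℤ → S) (k : ℤ × ℤ) : F.onMatrix (window l₁ r₁ l₂ r₂ c k) = F.next c k := by
  unfold onMatrix next window
  congr 1
  funext v
  have h := v.2
  simp only [rectNbhd, Finset.mem_product, Finset.mem_Icc] at h
  congr 1
  ext
  · simp only [Prod.fst_add]; omega
  · simp only [Prod.snd_add]; omega

theorem IsPeriod.next {N : Finset (ℤ × ℤ)} (F : CellularAutomaton S N) {c : ℤ × ℤ → S}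
    {p₁ p₂ : ℕ} (h : IsPeriod c p₁ p₂) : IsPeriod (F.next c) p₁ p₂ := by
  refine ⟨h.1, h.2.1, fun i j => ?_, fun i j => ?_⟩
  · refine congrArg F.f (funext fun v => ?_)
    have := h.2.2.1 (i + v.1.1) (j + v.1.2)
    rw [add_right_comm] at this
    exact this
  · refine congrArg F.f (funext fun v => ?_)
    have := h.2.2.2 (i + v.1.1) (j + v.1.2)
    rw [add_right_comm] at this
    exact this

theorem IsPeriod.cellSum_add {c : ℤ × ℤ → S} {p₁ p₂ : ℕ} (h : IsPeriod c p₁ p₂) (s t : ℤ) :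
    ∑ i ∈ Finset.range p₁, ∑ j ∈ Finset.range p₂, (c (i + s, j + t) : ℤ) = cellSum c p₁ p₂ :=
  sum_range_range_add_of_periodic (fun k => (c k : ℤ)) p₁ p₂ (fun i j => by rw [h.2.2.1])
    (fun i j => by rw [h.2.2.2]) s t

theorem NumberConserving.onMatrix_const {l₁ r₁ l₂ r₂ : ℕ}
    {F : CellularAutomaton S (rectNbhd l₁ r₁ l₂ r₂)} (hF : F.NumberConserving) (a : S) :
    F.onMatrix (fun _ _ => a) = a := by
  have h := hF (fun _ => a) 1 1 ⟨one_pos, one_pos, fun _ _ => rfl, fun _ _ => rfl⟩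
  have h' := onMatrix_window F (fun _ => a) (0, 0)
  simp only [cellSum, Finset.sum_range_one, Nat.cast_zero, ← h'] at h
  exact (Subtype.ext h).symm

/-! ### Necessity: block configurations -/

/-- The doubly periodic configuration with period `(2n, 2m)` whose fundamental cell is filled with
`a`, except for the entries of `x` in rows from `T` and columns from `L` on. -/
def blockConfig {m n : ℕ} (a : S) (x : Matrix (Fin m) (Fin n) S) (T L : ℕ) : ℤ × ℤ → S :=
  fun k =>
    if T ≤ (k.2 % (2 * m : ℕ)).toNat + 1 ∧ L ≤ (k.1 % (2 * n : ℕ)).toNat + 1 then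
      entry a x ((k.2 % (2 * m : ℕ)).toNat + 1) ((k.1 % (2 * n : ℕ)).toNat + 1)
    else a

theorem isPeriod_blockConfig {m n : ℕ} (hm : 0 < m) (hn : 0 < n) (a : S)
    (x : Matrix (Fin m) (Fin n) S) (T L : ℕ) :
    IsPeriod (blockConfig a x T L) (2 * n) (2 * m) :=
  ⟨by omega, by omega, fun i j => by simp only [blockConfig, Int.add_emod_right],
    fun i j => by simp only [blockConfig, Int.add_emod_right]⟩

theorem blockConfig_nat {m n : ℕ} (a : S) (x : Matrix (Fin m) (Fin n) S) (T L : ℕ) {i j : ℕ}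
    (hi : i < 2 * n) (hj : j < 2 * m) :
    blockConfig a x T L ((i : ℤ), (j : ℤ)) =
      if T ≤ j + 1 ∧ L ≤ i + 1 then entry a x (j + 1) (i + 1) else a := by
  have h1 : ((i : ℤ) % (2 * n : ℕ)).toNat = i := by
    rw [Int.emod_eq_of_lt (by omega) (by omega)]; simp
  have h2 : ((j : ℤ) % (2 * m : ℕ)).toNat = j := by
    rw [Int.emod_eq_of_lt (by omega) (by omega)]; simp
  simp only [blockConfig, h1, h2]

theorem blockConfig_of_neg {m n : ℕ} (a : S) (x : Matrix (Fin m) (Fin n) S) (T L : ℕ) {i j : ℤ}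
    (h : (-n < i ∧ i < 0) ∨ (-m < j ∧ j < 0)) : blockConfig a x T L (i, j) = a := by
  have key : m < (j % (2 * m : ℕ)).toNat + 1 ∨ n < (i % (2 * n : ℕ)).toNat + 1 := by
    rcases h with h | h
    · right
      -- The residue is `i + 2n > n`, beyond the block: the doubled period leaves a margin of `a`'s
      -- wide enough that no window meets two copies of the block.
      rw [← Int.add_emod_right, Int.emod_eq_of_lt (by omega) (by omega)]
      omega
    · left
      rw [← Int.add_emod_right, Int.emod_eq_of_lt (by omega) (by omega)]
      omega
  simp only [blockConfig, entry_of_gt a x key, ite_self]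

variable {l₁ r₁ l₂ r₂ : ℕ}

/-- The shift by `(-r₁, -r₂)` makes `(u, v)` the position of the window's last column and row, so
the window sees the block only up to there. -/
theorem window_blockConfig (a : S) (x : Matrix (Fin (l₂ + r₂ + 1)) (Fin (l₁ + r₁ + 1)) S)
    {T L : ℕ} (hT : 1 ≤ T) (hL : 1 ≤ L) {u v : ℕ} (hu : u < l₁ + r₁ + 1) (hv : v < l₂ + r₂ + 1) :
    window l₁ r₁ l₂ r₂ (blockConfig a x T L) ((u : ℤ) + -r₁, (v : ℤ) + -r₂) =
      cornerMatrix a x T L (v + 1) (u + 1) := by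
  funext p q
  have hp := p.2
  have hq := q.2
  simp only [window, cornerMatrix]
  by_cases h : l₁ + r₁ ≤ u + q ∧ l₂ + r₂ ≤ v + p
  · obtain ⟨s, hs⟩ := Nat.exists_eq_add_of_le h.1
    obtain ⟨t, ht⟩ := Nat.exists_eq_add_of_le h.2
    have e1 : (u : ℤ) + -r₁ + (q : ℕ) - l₁ = (s : ℤ) := by omega
    have e2 : (v : ℤ) + -r₂ + (p : ℕ) - l₂ = (t : ℤ) := by omega
    have e3 : (p : ℕ) + 1 + (v + 1) - (l₂ + r₂ + 1) = t + 1 := by omega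
    have e4 : (q : ℕ) + 1 + (u + 1) - (l₁ + r₁ + 1) = s + 1 := by omega
    rw [e1, e2, blockConfig_nat a x T L (by omega) (by omega), e3, e4]
    exact if_congr (by omega) rfl rfl
  · rw [blockConfig_of_neg a x T L (by omega), if_neg (by omega)]

/-- A window that misses the first column of the block does not see whether it is erased. -/
theorem window_blockConfig_erase_column (a : S)
    (x : Matrix (Fin (l₂ + r₂ + 1)) (Fin (l₁ + r₁ + 1)) S) (T : ℕ) {u : ℕ} (v : ℤ)
    (hu : l₁ + r₁ + 1 ≤ u) (hu' : u < 2 * (l₁ + r₁ + 1)) :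
    window l₁ r₁ l₂ r₂ (blockConfig a x T 1) ((u : ℤ) + -r₁, v) =
      window l₁ r₁ l₂ r₂ (blockConfig a x T 2) ((u : ℤ) + -r₁, v) := by
  funext p q
  have hq := q.2
  simp only [window, blockConfig]
  rw [Int.emod_eq_of_lt (a := (u : ℤ) + -r₁ + (q : ℕ) - l₁) (by omega) (by omega)]
  exact if_congr (by omega) rfl rfl

/-- A window that misses the first row of the block does not see whether it is erased. -/
theorem window_blockConfig_erase_row (a : S)
    (x : Matrix (Fin (l₂ + r₂ + 1)) (Fin (l₁ + r₁ + 1)) S) (L : ℕ) (u : ℤ) {v : ℕ}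
    (hv : l₂ + r₂ + 1 ≤ v) (hv' : v < 2 * (l₂ + r₂ + 1)) :
    window l₁ r₁ l₂ r₂ (blockConfig a x 1 L) (u, (v : ℤ) + -r₂) =
      window l₁ r₁ l₂ r₂ (blockConfig a x 2 L) (u, (v : ℤ) + -r₂) := by
  funext p q
  have hp := p.2
  simp only [window, blockConfig]
  rw [Int.emod_eq_of_lt (a := (v : ℤ) + -r₂ + (p : ℕ) - l₂) (by omega) (by omega)]
  exact if_congr (by omega) rfl rfl

/-- Away from the corner cell, erasing the row or erasing the column has no effect, so the four
terms cancel in pairs. -/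
theorem cellSum_blockConfig_mixed_difference {m n : ℕ} (hm : 0 < m) (hn : 0 < n) (a : S)
    (x : Matrix (Fin m) (Fin n) S) :
    cellSum (blockConfig a x 1 1) (2 * n) (2 * m) - cellSum (blockConfig a x 2 1) (2 * n) (2 * m)
      - cellSum (blockConfig a x 1 2) (2 * n) (2 * m)
      + cellSum (blockConfig a x 2 2) (2 * n) (2 * m) = ((entry a x 1 1 : S) : ℤ) - a := by
  simp only [cellSum, ← Finset.sum_add_distrib, ← Finset.sum_sub_distrib]
  rw [Finset.sum_eq_single_of_mem 0 (by simp [hn]), Finset.sum_eq_single_of_mem 0 (by simp [hm])]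
  · rw [blockConfig_nat a x 1 1 (by omega) (by omega), blockConfig_nat a x 1 2 (by omega) (by omega),
      blockConfig_nat a x 2 1 (by omega) (by omega), blockConfig_nat a x 2 2 (by omega) (by omega)]
    simp
  · intro j hj hj0
    rw [Finset.mem_range] at hj
    rw [blockConfig_nat a x 1 1 (by omega) (by omega), blockConfig_nat a x 1 2 (by omega) (by omega),
      blockConfig_nat a x 2 1 (by omega) (by omega), blockConfig_nat a x 2 2 (by omega) (by omega)]
    have : 2 ≤ j + 1 := by omega
    simp [this]
  · intro i hi hi0
    rw [Finset.mem_range] at hi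
    refine Finset.sum_eq_zero fun j hj => ?_
    rw [Finset.mem_range] at hj
    rw [blockConfig_nat a x 1 1 (by omega) (by omega), blockConfig_nat a x 1 2 (by omega) (by omega),
      blockConfig_nat a x 2 1 (by omega) (by omega), blockConfig_nat a x 2 2 (by omega) (by omega)]
    have : 2 ≤ i + 1 := by omega
    simp [this]

theorem cellSum_next_blockConfig_mixed_difference
    (F : CellularAutomaton S (rectNbhd l₁ r₁ l₂ r₂)) (a : S)
    (x : Matrix (Fin (l₂ + r₂ + 1)) (Fin (l₁ + r₁ + 1)) S) :
    cellSum (F.next (blockConfig a x 1 1)) (2 * (l₁ + r₁ + 1)) (2 * (l₂ + r₂ + 1))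
      - cellSum (F.next (blockConfig a x 2 1)) (2 * (l₁ + r₁ + 1)) (2 * (l₂ + r₂ + 1))
      - cellSum (F.next (blockConfig a x 1 2)) (2 * (l₁ + r₁ + 1)) (2 * (l₂ + r₂ + 1))
      + cellSum (F.next (blockConfig a x 2 2)) (2 * (l₁ + r₁ + 1)) (2 * (l₂ + r₂ + 1)) =
    ∑ v ∈ Finset.range (l₂ + r₂ + 1), ∑ u ∈ Finset.range (l₁ + r₁ + 1),
      ((F.onMatrix (cornerMatrix a x 1 1 (v + 1) (u + 1)) : ℤ)
        - F.onMatrix (cornerMatrix a x 2 1 (v + 1) (u + 1))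
        - F.onMatrix (cornerMatrix a x 1 2 (v + 1) (u + 1))
        + F.onMatrix (cornerMatrix a x 2 2 (v + 1) (u + 1))) := by
  have hper : ∀ T L, IsPeriod (F.next (blockConfig a x T L)) (2 * (l₁ + r₁ + 1))
      (2 * (l₂ + r₂ + 1)) := fun T L =>
    (isPeriod_blockConfig (Nat.succ_pos _) (Nat.succ_pos _) a x T L).next F
  simp only [fun T L => ((hper T L).cellSum_add (-r₁) (-r₂)).symm, ← Finset.sum_add_distrib,
    ← Finset.sum_sub_distrib, ← onMatrix_window]
  rw [Finset.sum_comm]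
  symm
  rw [← Finset.sum_subset (Finset.range_subset_range.2
    (by omega : l₂ + r₂ + 1 ≤ 2 * (l₂ + r₂ + 1)))]
  · refine Finset.sum_congr rfl fun v hv => ?_
    rw [Finset.mem_range] at hv
    rw [← Finset.sum_subset (Finset.range_subset_range.2
      (by omega : l₁ + r₁ + 1 ≤ 2 * (l₁ + r₁ + 1)))]
    · refine Finset.sum_congr rfl fun u hu => ?_
      rw [Finset.mem_range] at hu
      simp only [window_blockConfig a x (le_refl 1) (le_refl 1) hu hv,
        window_blockConfig a x (le_refl 1) one_le_two hu hv,
        window_blockConfig a x one_le_two (le_refl 1) hu hv,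
        window_blockConfig a x one_le_two one_le_two hu hv]
    · intro u hu hu'
      rw [Finset.mem_range] at hu hu'
      simp only [window_blockConfig_erase_column a x _ _ (not_lt.1 hu') hu]
      ring
  · intro v hv hv'
    rw [Finset.mem_range] at hv hv'
    refine Finset.sum_eq_zero fun u _ => ?_
    simp only [window_blockConfig_erase_row a x _ _ (not_lt.1 hv') hv]
    ring

/-! ### Sufficiency: translating blocks -/

/-- Blocks are pushed to the bottom right, so their position inside the window is forgotten; moving
the window by `(s, t)` brings the same cells to its top left. -/
theorem cornerMatrix_window (a : S) (c : ℤ × ℤ → S) (k : ℤ × ℤ) (s t B R : ℕ)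
    (hB : B + t ≤ l₂ + r₂ + 1) (hR : R + s ≤ l₁ + r₁ + 1) :
    cornerMatrix a (window l₁ r₁ l₂ r₂ c k) (1 + t) (1 + s) (B + t) (R + s) =
      cornerMatrix a (window l₁ r₁ l₂ r₂ c (k.1 + s, k.2 + t)) 1 1 B R := by
  funext p q
  have hp := p.2
  have hq := q.2
  simp only [cornerMatrix]
  refine ite_congr (by simp only [eq_iff_iff]; omega) (fun h => ?_) (fun _ => rfl)
  simp only [entry]
  rw [dif_pos (by omega), dif_pos (by omega)]
  simp only [window]
  congr 1
  ext <;> dsimp only <;> omega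

theorem isPeriod_onMatrix_cornerMatrix_window (F : CellularAutomaton S (rectNbhd l₁ r₁ l₂ r₂))
    (a : S) {c : ℤ × ℤ → S} {p₁ p₂ : ℕ} (h : IsPeriod c p₁ p₂) (B R : ℕ) :
    IsPeriod (fun k => F.onMatrix (cornerMatrix a (window l₁ r₁ l₂ r₂ c k) 1 1 B R)) p₁ p₂ := by
  refine ⟨h.1, h.2.1, fun i j => ?_, fun i j => ?_⟩
  · have : window l₁ r₁ l₂ r₂ c (i + p₁, j) = window l₁ r₁ l₂ r₂ c (i, j) := by
      funext p q
      have := h.2.2.1 (i + (q : ℕ) - l₁) (j + (p : ℕ) - l₂)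
      simp only [window, ← this]
      congr 2
      ring
    simp only [this]
  · have : window l₁ r₁ l₂ r₂ c (i, j + p₂) = window l₁ r₁ l₂ r₂ c (i, j) := by
      funext p q
      have := h.2.2.2 (i + (q : ℕ) - l₁) (j + (p : ℕ) - l₂)
      simp only [window, ← this]
      congr 2
      ring
    simp only [this]

/-- The sum over a period of the values of the local rule on a block of windows depends on the size
of the block only. -/
theorem sum_onMatrix_cornerMatrix_window (F : CellularAutomaton S (rectNbhd l₁ r₁ l₂ r₂))
    (a : S) {c : ℤ × ℤ → S} {p₁ p₂ : ℕ} (h : IsPeriod c p₁ p₂) (s t B R : ℕ)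
    (hB : B + t ≤ l₂ + r₂ + 1) (hR : R + s ≤ l₁ + r₁ + 1) :
    ∑ i ∈ Finset.range p₁, ∑ j ∈ Finset.range p₂,
      (F.onMatrix (cornerMatrix a (window l₁ r₁ l₂ r₂ c (i, j)) (1 + t) (1 + s)
        (B + t) (R + s)) : ℤ) =
    cellSum (fun k => F.onMatrix (cornerMatrix a (window l₁ r₁ l₂ r₂ c k) 1 1 B R)) p₁ p₂ := by
  rw [← (isPeriod_onMatrix_cornerMatrix_window F a h B R).cellSum_add s t]
  simp only [cornerMatrix_window a c _ s t B R hB hR]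

theorem cornerMatrix_full {α : Type*} {m n : ℕ} (a : α) (x : Matrix (Fin m) (Fin n) α) :
    cornerMatrix a x 1 1 m n = x := by
  funext p q
  have hp := p.2
  have hq := q.2
  simp only [cornerMatrix, entry]
  rw [if_pos (by omega), dif_pos (by omega)]
  congr 1 <;> ext <;> dsimp only <;> omega

end CellularAutomaton

/-! ### The equivalence -/

open CellularAutomaton in
theorem theorem2 (S : Finset ℤ) (l₁ r₁ l₂ r₂ m n : ℕ)
    (hn : n = l₁ + r₁ + 1) (hm : m = l₂ + r₂ + 1)
    (F : CellularAutomaton S (rectNbhd l₁ r₁ l₂ r₂)) (a : S) :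
    F.NumberConserving ↔
      ∀ x : Matrix (Fin (l₂ + r₂ + 1)) (Fin (l₁ + r₁ + 1)) S,
        let φ : ℕ → ℕ → ℕ → ℕ → ℤ := fun T L B R => ((F.onMatrix (cornerMatrix a x T L B R) : S) : ℤ)
        φ 1 1 m n =
          ((entry a x 1 1 : S) : ℤ)
          + ∑ i ∈ Finset.Icc 1 (m - 1), (φ 2 1 (i + 1) n - φ 1 1 i n)
          + ∑ j ∈ Finset.Icc 1 (n - 1), (φ 1 2 m (j + 1) - φ 1 1 m j)
          + ∑ i ∈ Finset.Icc 1 (m - 1), ∑ j ∈ Finset.Icc 1 (n - 1),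
              (φ 1 2 i (j + 1) + φ 2 1 (i + 1) j - φ 1 1 i j - φ 2 2 (i + 1) (j + 1)) := by
  subst hn hm
  simp only [Nat.add_sub_cancel]
  constructor
  · intro hF x
    have e1 := cellSum_blockConfig_mixed_difference (Nat.succ_pos _) (Nat.succ_pos _) a x
    have e2 := cellSum_next_blockConfig_mixed_difference F a x
    have hper := isPeriod_blockConfig (Nat.succ_pos _) (Nat.succ_pos _) a x
    -- Conservation turns the left side of `e2` into that of `e1`.
    simp only [← hF _ _ _ (hper _ _)] at e2
    have hc : ∀ T L B R, B < T ∨ R < L → (F.onMatrix (cornerMatrix a x T L B R) : ℤ) = a :=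
      fun T L B R h => by rw [cornerMatrix_eq_const a x h, hF.onMatrix_const a]
    have e3 := sum_mixed_difference
      (fun i j => (F.onMatrix (cornerMatrix a x 1 1 i j) : ℤ))
      (fun i j => (F.onMatrix (cornerMatrix a x 2 1 i j) : ℤ))
      (fun i j => (F.onMatrix (cornerMatrix a x 1 2 i j) : ℤ))
      (fun i j => (F.onMatrix (cornerMatrix a x 2 2 i j) : ℤ)) (a : ℤ)
      (fun j => hc _ _ _ _ (by omega)) (fun i => hc _ _ _ _ (by omega))
      (fun j => hc _ _ _ _ (by omega)) (fun i => hc _ _ _ _ (by omega)) (l₂ + r₂) (l₁ + r₁)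
    simp only [Nat.succ_eq_add_one] at e1 e2 e3
    linarith
  · intro H c p₁ p₂ hc
    have key := Finset.sum_congr (rfl : Finset.range p₁ = _) fun i _ =>
      Finset.sum_congr (rfl : Finset.range p₂ = _) fun j _ =>
        H (window l₁ r₁ l₂ r₂ c ((i : ℤ), (j : ℤ)))
    simp only [Finset.sum_add_distrib, cornerMatrix_full, onMatrix_window] at key
    have sum_rotate : ∀ (s : Finset ℕ) (g : ℕ → ℕ → ℕ → ℤ),
        ∑ i ∈ Finset.range p₁, ∑ j ∈ Finset.range p₂, ∑ k ∈ s, g i j k =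
        ∑ k ∈ s, ∑ i ∈ Finset.range p₁, ∑ j ∈ Finset.range p₂, g i j k := fun s g => by
      rw [Finset.sum_congr rfl fun i _ => Finset.sum_comm, Finset.sum_comm]
    have s11 := fun B R hB hR => sum_onMatrix_cornerMatrix_window F a hc 0 0 B R hB hR
    have s12 := fun B R hB hR => sum_onMatrix_cornerMatrix_window F a hc 1 0 B R hB hR
    have s21 := fun B R hB hR => sum_onMatrix_cornerMatrix_window F a hc 0 1 B R hB hR
    have s22 := fun B R hB hR => sum_onMatrix_cornerMatrix_window F a hc 1 1 B R hB hR
    simp only [add_zero, Nat.reduceAdd] at s11 s12 s21 s22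
    -- The top left cell of a window is its centre moved by `(-l₁, -l₂)`, so these entries sum to
    -- the cell sum of `c`.
    have hentry : ∀ i j : ℕ, entry a (window l₁ r₁ l₂ r₂ c ((i : ℤ), (j : ℤ))) 1 1 =
        c ((i : ℤ) + -l₁, (j : ℤ) + -l₂) := fun i j => by
      simp [entry, window, sub_eq_add_neg]
    simp only [sum_rotate, hentry, hc.cellSum_add] at key
    simp only [Finset.sum_add_distrib, Finset.sum_sub_distrib] at key
    -- Each sum is reduced to the one for a block of the same size (`i × n`, `m × j` or `i × j`)
    -- starting at the top left; they then cancel.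
    rw [Finset.sum_congr rfl fun i hi => s21 i (l₁ + r₁ + 1)
        (Nat.succ_le_succ (Finset.mem_Icc.1 hi).2) le_rfl,
      Finset.sum_congr rfl fun i hi => s11 i (l₁ + r₁ + 1)
        (Nat.le_succ_of_le (Finset.mem_Icc.1 hi).2) le_rfl,
      Finset.sum_congr rfl fun j hj => s12 (l₂ + r₂ + 1) j le_rfl
        (Nat.succ_le_succ (Finset.mem_Icc.1 hj).2),
      Finset.sum_congr rfl fun j hj => s11 (l₂ + r₂ + 1) j le_rfl
        (Nat.le_succ_of_le (Finset.mem_Icc.1 hj).2),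
      Finset.sum_congr rfl fun i hi => Finset.sum_congr rfl fun j hj => s12 i j
        (Nat.le_succ_of_le (Finset.mem_Icc.1 hi).2) (Nat.succ_le_succ (Finset.mem_Icc.1 hj).2),
      Finset.sum_congr rfl fun i hi => Finset.sum_congr rfl fun j hj => s21 i j
        (Nat.succ_le_succ (Finset.mem_Icc.1 hi).2) (Nat.le_succ_of_le (Finset.mem_Icc.1 hj).2),
      Finset.sum_congr rfl fun i hi => Finset.sum_congr rfl fun j hj => s11 i j
        (Nat.le_succ_of_le (Finset.mem_Icc.1 hi).2) (Nat.le_succ_of_le (Finset.mem_Icc.1 hj).2),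
      Finset.sum_congr rfl fun i hi => Finset.sum_congr rfl fun j hj => s22 i j
        (Nat.succ_le_succ (Finset.mem_Icc.1 hi).2) (Nat.succ_le_succ (Finset.mem_Icc.1 hj).2)]
      at key
    change cellSum (F.next c) p₁ p₂ = _ at key
    linarith
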